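/- Let $G$ be a compact Hausdorff group, let $A$ be a unital C*-algebra, and let $\alpha: G \to \mathrm{Aut}(A)$ be an action by *-automorphisms such that $(g,x) \mapsto \alpha_g(x)$ is continuous on $G \times A$. Assume that the C*-dynamical system $(A,G,\alpha)$ is free, i.e. that the Ellwood map $A \otimes_{\mathrm{alg}} A \to C(G,A)$, $x \otimes y \mapsto \bigl(g \mapsto x\,\alpha_g(y)\bigr)$, has dense range with respect to the supremum norm. For an irreducible unitary representation $(\sigma, V_\sigma)$ of $G$ (continuous, on a finite-dimensional complex Hilbert space) and a representation of $G$ on a complex vector space $W$, let $W(\sigma)$ denote the $\sigma$-isotypic component of $W$, i.e. the linear span of the images of all $G$-equivariant linear maps $V_\sigma \to W$; let $W(1)$ be the isotypic component of the trivial representation on $\mathbb{C}$. Let $(\pi,u)$ be a covariant representation of $(A,G,\alpha)$ on a complex Hilbert space $H_A$, i.e. a unital *-representation $\pi$ of $A$ on $H_A$ and a strongly continuous unitary representation $u$ of $G$ on $H_A$ with $u_g\,\pi(a)\,u_g^* = \pi(\alpha_g(a))$ for all $g \in G$, $a \in A$. Then for every irreducible representation $\sigma$ of $G$ $$\pi\bigl(A(\sigma)\bigr)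 \,.\, H_A(1) = H_A(\sigma),$$ where the left-hand side is the linear span (without closure) of $\{\pi(a)\xi : a \in A(\sigma),\ \xi \in H_A(1)\}$. -/

import Mathlib

open scoped TensorProduct

/-- A C*-dynamical system `(A, G, α)`: a group `G` acting on a unital C*-algebra `A` by
*-automorphisms `α g`, jointly continuously. -/
structure CStarDynamicalSystem (A G : Type*) [CStarAlgebra A] [Group G] [TopologicalSpace G] where
  /-- The action `g ↦ α_g`. -/
  act : G →* (A ≃⋆ₐ[ℂ] A)
  continuous_act : Continuous fun p : G × A => act p.1 p.2

/-- A (strongly continuous) unitary representation of `G` on the inner product space `H`. -/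
structure UnitaryRep (G H : Type*) [Group G] [TopologicalSpace G] [NormedAddCommGroup H]
    [InnerProductSpace ℂ H] where
  /-- The homomorphism `g ↦ u_g` into the unitary operators. -/
  act : G →* (H ≃ₗᵢ[ℂ] H)
  continuous_act : ∀ ξ : H, Continuous fun g : G => act g ξ

/-- The underlying linear representation of a unitary representation. -/
def UnitaryRep.rep {G H : Type*} [Group G] [TopologicalSpace G] [NormedAddCommGroup H]
    [InnerProductSpace ℂ H] (u : UnitaryRep G H) : Representation ℂ G H where
  toFun g := (u.act g).toLinearEquiv.toLinearMap
  map_one' := by ext ξ; simp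
  map_mul' g h := by ext ξ; simp

/-- The isotypic component of the representation `ρ` of type `σ`: the sum of the images of all
intertwining maps from `σ` to `ρ`. For irreducible `σ` these images are the zero subspace and the
subrepresentations of `ρ` equivalent to `σ`. -/
def isotypicPart {G V W : Type*} [Group G] [AddCommGroup V] [Module ℂ V] [AddCommGroup W]
    [Module ℂ W] (σ : Representation ℂ G V) (ρ : Representation ℂ G W) : Submodule ℂ W :=
  ⨆ T : Representation.IntertwiningMap σ ρ, LinearMap.range T.toLinearMap

namespace CStarDynamicalSystem

variable {A G : Type*} [CStarAlgebra A] [Group G] [TopologicalSpace G]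

/-- The action on the algebra, regarded as a linear representation. -/
noncomputable def rep (S : CStarDynamicalSystem A G) : Representation ℂ G A where
  toFun g := (S.act g).toAlgEquiv.toLinearMap
  map_one' := by ext x; simp
  map_mul' g h := by ext x; simp

/-- The Ellwood map `A ⊗ A → C(G, A)`, `x ⊗ y ↦ (g ↦ x * α_g y)`, on the algebraic tensor product. -/
noncomputable def ellwoodMap (S : CStarDynamicalSystem A G) : A ⊗[ℂ] A →ₗ[ℂ] C(G, A) :=
  TensorProduct.lift <| LinearMap.mk₂ ℂ
    (fun x y => ⟨fun g => x * S.act g y, continuous_const.mul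
      (S.continuous_act.comp (continuous_id.prodMk continuous_const))⟩)
    (by intros; ext; simp [add_mul])
    (by intros; ext; simp)
    (by intros; ext; simp [mul_add])
    (by intros; ext; simp)

/-- Freeness in the sense of Ellwood: the Ellwood map has dense range. For compact `G` the topology
of `C(G, A)` is that of the supremum norm. -/
def IsFree (S : CStarDynamicalSystem A G) : Prop := DenseRange S.ellwoodMap

/-- A covariant representation `(π, u)` on the Hilbert space `H`: a unital *-representation of `A`
and a unitary representation of `G` with `u_g π(a) u_g⁻¹ = π(α_g a)`. -/
structure CovariantRep (S : CStarDynamicalSystem A G) (H : Type*) [NormedAddCommGroup H]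
    [InnerProductSpace ℂ H] [CompleteSpace H] where
  /-- The representation of the algebra. -/
  π : A →⋆ₐ[ℂ] (H →L[ℂ] H)
  /-- The representation of the group. -/
  u : UnitaryRep G H
  covariant : ∀ (g : G) (a : A) (ξ : H), u.act g (π a ((u.act g).symm ξ)) = π (S.act g a) ξ

end CStarDynamicalSystem

/-!
Every intertwiner `T : V → H` has to be written as a finite sum of products `π(a) ξ` with `a` of
type `σ` and `ξ` fixed; the other inclusion is immediate from covariance. Let `P = ∫ u_h dh` be the
projection onto the fixed vectors, and for `F ∈ C(G, A)` let `Q_F = ∫ π(F(h)) u_h dh`.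

* If `F` is the image of `∑ xᵢ ⊗ yᵢ` under the Ellwood map, then `Q_F = ∑ π(xᵢ) P π(yᵢ)`. The
  average `∫ u_g Q_F B σ_g⁻¹ dg` of `Q_F B` over the group, for any operator `B : V → H`, is
  obtained by expanding `σ_g⁻¹ v` in an orthonormal basis `(e_k)`: since `u_g π(x) P = π(α_g x) P`,
  it maps `v` to `∑ π(∫ ⟪e_k, σ_g⁻¹ v⟫ α_g(xᵢ) dg) P π(yᵢ) B e_k`, a finite sum of the required
  form (`averageOperator_integrated_ellwoodMap_mem`).
* If `F` is uniformly close to `f · 1` with `f` a probability density concentrated near the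
  identity of `G`, then `Q_F T` is close to `T`, uniformly over the intertwiners `T` of norm one,
  because `u_h T = T σ_h` and `h ↦ σ_h` is norm continuous (`norm_integrated_sub_le`). Freeness
  provides such an `F` in the range of the Ellwood map.

Fix such an `F`. Composition with `Q_F` followed by averaging is an operator on the Banach space of
intertwiners, and it is at distance at most `1/2` from the identity, since averaging is contractive
and fixes intertwiners. Hence it is surjective, so each intertwiner is an average as in the first
item. It is this surjectivity, with one tensor `∑ xᵢ ⊗ yᵢ` serving all intertwiners, that makes a
closure unnecessary. The argument does not decompose `σ`, so it needs no orthogonality relations.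
-/

open MeasureTheory

/-! ### Preliminaries on Banach spaces -/

/-- A continuous function on a compact space is integrable for every finite Borel measure. -/
theorem Continuous.integrable_of_compactSpace {X E : Type*} [TopologicalSpace X] [CompactSpace X]
    [MeasurableSpace X] [BorelSpace X] [NormedAddCommGroup E] {μ : Measure X}
    [IsFiniteMeasure μ] {f : X → E} (hf : Continuous f) : Integrable f μ :=
  hf.integrable_of_hasCompactSupport (HasCompactSupport.of_compactSpace f)

/-- A linear endomorphism of a Banach space at distance less than one from the identity is
surjective. -/
theorem LinearMap.surjective_of_norm_sub_le {X : Type*} [NormedAddCommGroup X] [NormedSpace ℂ X]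
    [CompleteSpace X] (Φ : X →ₗ[ℂ] X) {c : ℝ} (hc₀ : 0 ≤ c) (hc : c < 1)
    (h : ∀ x, ‖x - Φ x‖ ≤ c * ‖x‖) : Function.Surjective Φ := by
  let D : X →L[ℂ] X := (LinearMap.id - Φ).mkContinuous c h
  have hD : ‖D‖ < 1 := (LinearMap.mkContinuous_norm_le _ hc₀ h).trans_lt hc
  let U := Units.oneSub D hD
  have hU : ∀ x, (U : X →L[ℂ] X) x = Φ x := fun x => by simp [U, D]
  intro y
  refine ⟨(↑U⁻¹ : X →L[ℂ] X) y, ?_⟩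
  rw [← hU]
  exact DFunLike.congr_fun U.mul_inv y

namespace UnitaryRep

/-! ### Unitary representations and intertwiners -/

section Basic

variable {G : Type*} [Group G] [TopologicalSpace G]
  {H : Type*} [NormedAddCommGroup H] [InnerProductSpace ℂ H]
  {V : Type*} [NormedAddCommGroup V] [InnerProductSpace ℂ V]

@[simp]
theorem rep_apply (u : UnitaryRep G H) (g : G) (ξ : H) : u.rep g ξ = u.act g ξ := rfl

theorem act_mul_apply (u : UnitaryRep G H) (g h : G) (ξ : H) :
    u.act (g * h) ξ = u.act g (u.act h ξ) := by simp

theorem act_inv_act (u : UnitaryRep G H) (g : G) (ξ : H) : u.act g⁻¹ (u.act g ξ) = ξ := by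
  rw [← act_mul_apply]; simp

theorem act_act_inv (u : UnitaryRep G H) (g : G) (ξ : H) : u.act g (u.act g⁻¹ ξ) = ξ := by
  rw [← act_mul_apply]; simp

/-- A strongly continuous representation by isometries is jointly continuous. -/
theorem continuous_act_apply (u : UnitaryRep G H) {X : Type*} [TopologicalSpace X] {p : X → G}
    {f : X → H} (hp : Continuous p) (hf : Continuous f) :
    Continuous fun x => u.act (p x) (f x) := by
  rw [continuous_iff_continuousAt]
  intro x
  have h₁ : Filter.Tendsto (fun y => u.act (p y) (f y - f x)) (nhds x) (nhds 0) := by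
    rw [tendsto_zero_iff_norm_tendsto_zero]
    simp only [LinearIsometryEquiv.norm_map]
    rw [← tendsto_zero_iff_norm_tendsto_zero, tendsto_sub_nhds_zero_iff]
    exact hf.continuousAt
  have h₂ : Filter.Tendsto (fun y => u.act (p y) (f x)) (nhds x) (nhds (u.act (p x) (f x))) :=
    ((u.continuous_act (f x)).comp hp).continuousAt
  simpa [ContinuousAt] using h₁.add h₂

/-- The closed subspace of bounded operators intertwining `σ` and `u`. -/
def intertwiners (σ : UnitaryRep G V) (u : UnitaryRep G H) : Submodule ℂ (V →L[ℂ] H) where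
  carrier := {T | ∀ g v, T (σ.act g v) = u.act g (T v)}
  add_mem' hS hT g v := by simp [hS g v, hT g v]
  zero_mem' g v := by simp
  smul_mem' c T hT g v := by simp [hT g v]

theorem mem_intertwiners {σ : UnitaryRep G V} {u : UnitaryRep G H} {T : V →L[ℂ] H} :
    T ∈ intertwiners σ u ↔ ∀ g v, T (σ.act g v) = u.act g (T v) := Iff.rfl

theorem isClosed_intertwiners (σ : UnitaryRep G V) (u : UnitaryRep G H) :
    IsClosed (intertwiners σ u : Set (V →L[ℂ] H)) := by
  have : (intertwiners σ u : Set (V →L[ℂ] H)) =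
      ⋂ g, ⋂ v, {T | T (σ.act g v) = u.act g (T v)} := by
    ext T; simp [mem_intertwiners]
  rw [this]
  exact isClosed_iInter fun g => isClosed_iInter fun v =>
    isClosed_eq (by fun_prop) (by fun_prop)

/-- The isotypic component of the trivial representation is the space of fixed vectors. -/
theorem mem_isotypicPart_trivial {u : UnitaryRep G H} {ξ : H} :
    ξ ∈ isotypicPart (Representation.trivial ℂ G ℂ) u.rep ↔ ∀ g, u.act g ξ = ξ := by
  constructor
  · intro hξ g
    have hle : isotypicPart (Representation.trivial ℂ G ℂ) u.rep ≤
        LinearMap.eqLocus (u.rep g) LinearMap.id := by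
      refine iSup_le fun T => ?_
      rintro _ ⟨c, rfl⟩
      have h := T.isIntertwining _ _ g c
      simp only [Representation.trivial, MonoidHom.one_apply, Module.End.one_apply] at h
      exact h.symm
    exact hle hξ
  · intro h
    let T : Representation.IntertwiningMap (Representation.trivial ℂ G ℂ) u.rep :=
      (LinearMap.toSpanSingleton ℂ H ξ).intertwiningMap_of_isIntertwiningMap _ _
        fun g c => by simp [h g]
    exact Submodule.mem_iSup_of_mem T ⟨1, one_smul ℂ ξ⟩

/-- On a finite-dimensional space, the isotypic component is the sum of the ranges of the bounded
intertwining operators. -/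
theorem isotypicPart_le_of_intertwiners [FiniteDimensional ℂ V] (σ : UnitaryRep G V)
    (u : UnitaryRep G H) {K : Submodule ℂ H} (hK : ∀ T ∈ intertwiners σ u, ∀ v, T v ∈ K) :
    isotypicPart σ.rep u.rep ≤ K := by
  refine iSup_le fun T => ?_
  rintro _ ⟨v, rfl⟩
  exact hK T.toLinearMap.toContinuousLinearMap (fun g v => T.isIntertwining _ _ g v) v

theorem act_integral {X : Type*} [MeasurableSpace X] (μ : Measure X) (u : UnitaryRep G H) (g : G)
    (f : X → H) :
    u.act g (∫ h, f h ∂μ) = ∫ h, u.act g (f h) ∂μ :=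
  ((u.act g).toContinuousLinearEquiv.integral_comp_comm f).symm

/-- Averaging a vector over the group yields a fixed vector. -/
theorem act_integral_act [IsTopologicalGroup G] [MeasurableSpace G] [BorelSpace G]
    (μ : Measure G) [μ.IsMulLeftInvariant] (u : UnitaryRep G H) (g : G) (ξ : H) :
    u.act g (∫ h, u.act h ξ ∂μ) = ∫ h, u.act h ξ ∂μ := by
  calc u.act g (∫ h, u.act h ξ ∂μ) = ∫ h, u.act (g * h) ξ ∂μ := by
        simp only [act_integral, act_mul_apply]
    _ = ∫ h, u.act h ξ ∂μ := integral_mul_left_eq_self (fun h => u.act h ξ) g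

theorem norm_integral_conj_le [MeasurableSpace G] (μ : Measure G) [IsProbabilityMeasure μ]
    (σ : UnitaryRep G V) (u : UnitaryRep G H) (B : V →L[ℂ] H)
    (v : V) :
    ‖∫ g, u.act g (B (σ.act g⁻¹ v)) ∂μ‖ ≤ ‖B‖ * ‖v‖ := by
  refine (norm_integral_le_of_norm_le_const (C := ‖B‖ * ‖v‖)
    (Filter.Eventually.of_forall fun g => ?_)).trans_eq (by simp)
  rw [LinearIsometryEquiv.norm_map]
  exact (B.le_opNorm _).trans_eq (by rw [LinearIsometryEquiv.norm_map])

end Basic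

/-! ### Averaging over the group -/

section Averaging

variable {G : Type*} [Group G] [TopologicalSpace G] [IsTopologicalGroup G] [CompactSpace G]
  [MeasurableSpace G] [BorelSpace G] (μ : Measure G) [IsProbabilityMeasure μ]
  {H : Type*} [NormedAddCommGroup H] [InnerProductSpace ℂ H]
  {V : Type*} [NormedAddCommGroup V] [InnerProductSpace ℂ V]

theorem integrable_conj (σ : UnitaryRep G V) (u : UnitaryRep G H) (B : V →L[ℂ] H) (v : V) :
    Integrable (fun g => u.act g (B (σ.act g⁻¹ v))) μ :=
  (u.continuous_act_apply continuous_id (B.continuous.comp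
    ((σ.continuous_act v).comp continuous_inv))).integrable_of_compactSpace

/-- The average `v ↦ ∫ u_g B σ_g⁻¹ v dg` of the operator `B` over the group. If `H` is
not complete, the Bochner integral and hence the average are zero. -/
noncomputable def averageOperator (σ : UnitaryRep G V) (u : UnitaryRep G H) :
    (V →L[ℂ] H) →ₗ[ℂ] (V →L[ℂ] H) :=
  { toFun B := LinearMap.mkContinuous
      { toFun v := ∫ g, u.act g (B (σ.act g⁻¹ v)) ∂μ
        map_add' v w := by
          simp only [map_add]
          exact integral_add (integrable_conj μ σ u B v) (integrable_conj μ σ u B w)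
        map_smul' c v := by simp only [map_smul, RingHom.id_apply]; exact integral_smul c _ }
      ‖B‖ (norm_integral_conj_le μ σ u B)
    map_add' B C := by
      ext v
      simpa using integral_add (integrable_conj μ σ u B v) (integrable_conj μ σ u C v)
    map_smul' c B := by
      ext v
      simpa using integral_smul c (fun g => u.act g (B (σ.act g⁻¹ v))) }

theorem averageOperator_apply (σ : UnitaryRep G V) (u : UnitaryRep G H) (B : V →L[ℂ] H) (v : V) :
    averageOperator μ σ u B v = ∫ g, u.act g (B (σ.act g⁻¹ v)) ∂μ := rfl

theorem norm_averageOperator_le (σ : UnitaryRep G V) (u : UnitaryRep G H) (B : V →L[ℂ] H) :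
    ‖averageOperator μ σ u B‖ ≤ ‖B‖ :=
  LinearMap.mkContinuous_norm_le _ (norm_nonneg B) (norm_integral_conj_le μ σ u B)

theorem averageOperator_mem_intertwiners [μ.IsMulLeftInvariant] (σ : UnitaryRep G V)
    (u : UnitaryRep G H) (B : V →L[ℂ] H) :
    averageOperator μ σ u B ∈ intertwiners σ u := by
  intro h v
  rw [averageOperator_apply, averageOperator_apply, act_integral,
    ← integral_mul_left_eq_self (fun g => u.act g (B (σ.act g⁻¹ (σ.act h v)))) h]
  simp only [mul_inv_rev, act_mul_apply, act_inv_act]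

theorem averageOperator_eq_self [CompleteSpace H] {σ : UnitaryRep G V} {u : UnitaryRep G H}
    {T : V →L[ℂ] H} (hT : T ∈ intertwiners σ u) : averageOperator μ σ u T = T := by
  ext v
  simp only [averageOperator_apply, mem_intertwiners.1 hT, act_act_inv, integral_const,
    probReal_univ, one_smul]

/-- Composition with `Q` followed by averaging, as an operator on the space of intertwiners. -/
noncomputable def intertwinerCompression [μ.IsMulLeftInvariant] (σ : UnitaryRep G V)
    (u : UnitaryRep G H) (Q : H →L[ℂ] H) : intertwiners σ u →ₗ[ℂ] intertwiners σ u where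
  toFun T := ⟨averageOperator μ σ u (Q ∘L (T : V →L[ℂ] H)),
    averageOperator_mem_intertwiners μ σ u _⟩
  map_add' T T' := Subtype.ext <|
    (congrArg _ (Q.comp_add (T : V →L[ℂ] H) T')).trans (map_add _ _ _)
  map_smul' c T := Subtype.ext <|
    (congrArg _ (Q.comp_smul c (T : V →L[ℂ] H))).trans (map_smul _ _ _)

theorem coe_intertwinerCompression [μ.IsMulLeftInvariant] (σ : UnitaryRep G V)
    (u : UnitaryRep G H) (Q : H →L[ℂ] H) (T : intertwiners σ u) :
    (intertwinerCompression μ σ u Q T : V →L[ℂ] H) =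
      averageOperator μ σ u (Q ∘L (T : V →L[ℂ] H)) := rfl

/-- Averaging does not increase the distance of `Q ∘ T` from the intertwiner `T`. -/
theorem norm_sub_intertwinerCompression_le [CompleteSpace H] [μ.IsMulLeftInvariant]
    (σ : UnitaryRep G V) (u : UnitaryRep G H) (Q : H →L[ℂ] H) (T : intertwiners σ u) :
    ‖T - intertwinerCompression μ σ u Q T‖ ≤
      ‖(T : V →L[ℂ] H) - Q ∘L (T : V →L[ℂ] H)‖ := by
  rw [← Submodule.norm_coe, Submodule.coe_sub, coe_intertwinerCompression]
  nth_rewrite 1 [← averageOperator_eq_self μ T.2]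
  rw [← map_sub]
  exact norm_averageOperator_le μ σ u _

/-- Approximate identities: in a finite-dimensional representation `σ`, smearing with a suitable
probability density concentrated near the identity moves all vectors by little. -/
theorem exists_density_norm_sub_le [T2Space G] [μ.IsOpenPosMeasure] [FiniteDimensional ℂ V]
    (σ : UnitaryRep G V) {ε : ℝ} (hε : 0 < ε) :
    ∃ f : C(G, ℝ), (∀ g, 0 ≤ f g) ∧ ∫ g, f g ∂μ = 1 ∧
      ∀ g v, f g * ‖σ.act g v - v‖ ≤ f g * (ε * ‖v‖) := by
  let L : G → V →L[ℂ] V := fun g =>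
    ((σ.act g : V ≃ₗᵢ[ℂ] V).toContinuousLinearEquiv : V →L[ℂ] V) - ContinuousLinearMap.id ℂ V
  have hL : Continuous L :=
    continuous_clm_apply.2 fun v => (σ.continuous_act v).sub continuous_const
  have hU : IsOpen {g | ‖L g‖ < ε} := isOpen_lt hL.norm continuous_const
  have hd : Disjoint {g | ‖L g‖ < ε}ᶜ {(1 : G)} := by
    have : L 1 = 0 := by ext v; simp [L]
    simp [this, hε]
  obtain ⟨f, hf0, hf1, hf⟩ :=
    exists_continuous_zero_one_of_isClosed hU.isClosed_compl isClosed_singleton hd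
  have hpos : 0 < ∫ g, f g ∂μ :=
    f.continuous.integral_pos_of_hasCompactSupport_nonneg_nonzero
      (HasCompactSupport.of_compactSpace _) (fun g => (hf g).1) (x := 1)
      (by rw [hf1 rfl]; exact one_ne_zero)
  refine ⟨(∫ g, f g ∂μ)⁻¹ • f, fun g => ?_, ?_, fun g v => ?_⟩
  · exact mul_nonneg (inv_nonneg.2 hpos.le) (hf g).1
  · simp only [ContinuousMap.smul_apply, smul_eq_mul]
    rw [integral_const_mul, inv_mul_cancel₀ hpos.ne']
  · by_cases hg : ‖L g‖ < ε
    · refine mul_le_mul_of_nonneg_left ?_ (mul_nonneg (inv_nonneg.2 hpos.le) (hf g).1)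
      exact ((L g).le_opNorm v).trans (mul_le_mul_of_nonneg_right hg.le (norm_nonneg v))
    · simp [hf0 hg]

end Averaging

end UnitaryRep

/-! ### Crossed product operators and the Ellwood map -/

namespace CStarDynamicalSystem

open UnitaryRep

variable {A G : Type*} [CStarAlgebra A] [Group G] [TopologicalSpace G]
  {S : CStarDynamicalSystem A G}
  {H : Type*} [NormedAddCommGroup H] [InnerProductSpace ℂ H] [CompleteSpace H]

@[simp]
theorem ellwoodMap_tmul (x y : A) (g : G) : S.ellwoodMap (x ⊗ₜ y) g = x * S.act g y := rfl

@[simp]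
theorem rep_apply (g : G) (a : A) : S.rep g a = S.act g a := rfl

namespace CovariantRep

variable (R : S.CovariantRep H)

theorem act_π (g : G) (a : A) (ξ : H) :
    R.u.act g (R.π a ξ) = R.π (S.act g a) (R.u.act g ξ) := by
  rw [← R.covariant, LinearIsometryEquiv.symm_apply_apply]

theorem norm_π_apply_le (a : A) (ξ : H) : ‖R.π a ξ‖ ≤ ‖a‖ * ‖ξ‖ :=
  (ContinuousLinearMap.le_opNorm _ _).trans
    (mul_le_mul_of_nonneg_right (NonUnitalStarAlgHom.norm_apply_le R.π a) (norm_nonneg ξ))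

theorem continuous_π : Continuous R.π :=
  AddMonoidHomClass.continuous_of_bound R.π 1 fun a => by
    simpa using NonUnitalStarAlgHom.norm_apply_le R.π a

/-- Multiplying a vector of type `σ` of the algebra with a fixed vector gives a vector of
type `σ`. -/
theorem span_le_isotypicPart {V : Type*} [AddCommGroup V] [Module ℂ V] (σ : Representation ℂ G V) :
    Submodule.span ℂ {η : H | ∃ a ∈ isotypicPart σ S.rep,
        ∃ ξ ∈ isotypicPart (Representation.trivial ℂ G ℂ) R.u.rep, R.π a ξ = η} ≤
      isotypicPart σ R.u.rep := by
  refine Submodule.span_le.2 ?_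
  rintro _ ⟨a, ha, ξ, hξ, rfl⟩
  rw [mem_isotypicPart_trivial] at hξ
  let ev : A →ₗ[ℂ] H :=
    { toFun a := R.π a ξ
      map_add' a b := by simp
      map_smul' c a := by simp }
  suffices isotypicPart σ S.rep ≤ (isotypicPart σ R.u.rep).comap ev from this ha
  refine iSup_le fun T => ?_
  rintro _ ⟨v, rfl⟩
  let T' : Representation.IntertwiningMap σ R.u.rep :=
    (ev ∘ₗ T.toLinearMap).intertwiningMap_of_isIntertwiningMap _ _ fun g w => by
      change R.π (T (σ g w)) ξ = R.u.act g (R.π (T w) ξ)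
      rw [T.isIntertwining, rep_apply, act_π, hξ]
  exact Submodule.mem_iSup_of_mem T' ⟨v, rfl⟩

variable [CompactSpace G] [MeasurableSpace G] [BorelSpace G]
  (μ : Measure G) [IsProbabilityMeasure μ]

theorem integrable_π_act (F : C(G, A)) (ξ : H) :
    Integrable (fun g => R.π (F g) (R.u.act g ξ)) μ :=
  ((R.continuous_π.comp F.continuous).clm_apply
    (R.u.continuous_act ξ)).integrable_of_compactSpace

/-- The integrated form `∫ π(F(g)) u_g dg` of the covariant representation on continuous
functions. -/
noncomputable def integrated : C(G, A) →ₗ[ℂ] (H →L[ℂ] H) where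
  toFun F := LinearMap.mkContinuous
    { toFun ξ := ∫ g, R.π (F g) (R.u.act g ξ) ∂μ
      map_add' ξ η := by
        simp only [map_add]
        exact integral_add (R.integrable_π_act μ F ξ) (R.integrable_π_act μ F η)
      map_smul' c ξ := by simp only [map_smul, RingHom.id_apply]; exact integral_smul c _ }
    ‖F‖ fun ξ => by
      refine (norm_integral_le_of_norm_le_const (C := ‖F‖ * ‖ξ‖)
        (Filter.Eventually.of_forall fun g => ?_)).trans_eq (by simp)
      refine (R.norm_π_apply_le _ _).trans ?_
      rw [LinearIsometryEquiv.norm_map]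
      exact mul_le_mul_of_nonneg_right (F.norm_coe_le_norm g) (norm_nonneg ξ)
  map_add' E F := by
    ext ξ
    simpa using integral_add (R.integrable_π_act μ E ξ) (R.integrable_π_act μ F ξ)
  map_smul' c F := by
    ext ξ
    simpa using integral_smul c (fun g => R.π (F g) (R.u.act g ξ))

theorem integrated_apply (F : C(G, A)) (ξ : H) :
    R.integrated μ F ξ = ∫ g, R.π (F g) (R.u.act g ξ) ∂μ := rfl

/-- On an elementary tensor the Ellwood map integrates to `π(x) P π(y)`, with `P` the projection
onto the fixed vectors. -/
theorem integrated_ellwoodMap_tmul (x y : A) (ξ : H) :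
    R.integrated μ (S.ellwoodMap (x ⊗ₜ y)) ξ = R.π x (∫ g, R.u.act g (R.π y ξ) ∂μ) := by
  rw [← ContinuousLinearMap.integral_comp_comm _
    (R.u.continuous_act _).integrable_of_compactSpace, integrated_apply]
  simp [act_π]

variable {V : Type*} [NormedAddCommGroup V] [InnerProductSpace ℂ V] (σ : UnitaryRep G V)

/-- If the values of `F` are nearly scalars forming an approximate identity for `σ`, then the
integrated form of `F` is close to the identity on the ranges of intertwining operators. -/
theorem norm_integrated_sub_le {ε δ : ℝ} (F : C(G, A)) (f : C(G, ℝ))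
    (hf₀ : ∀ g, 0 ≤ f g) (hf₁ : ∫ g, f g ∂μ = 1)
    (hf : ∀ g v, f g * ‖σ.act g v - v‖ ≤ f g * (ε * ‖v‖))
    (hF : ∀ g, ‖F g - algebraMap ℂ A (f g)‖ ≤ δ) {T : V →L[ℂ] H} (hT : T ∈ intertwiners σ R.u)
    (v : V) : ‖T v - R.integrated μ F (T v)‖ ≤ (ε + δ) * ‖T‖ * ‖v‖ := by
  have hfi : Integrable f μ := f.continuous.integrable_of_compactSpace
  have hfc : Integrable (fun g => (f g : ℂ) • T v) μ :=
    Continuous.integrable_of_compactSpace (by fun_prop)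
  have h1 : T v = ∫ g, (f g : ℂ) • T v ∂μ := by
    rw [integral_smul_const, integral_complex_ofReal, hf₁, Complex.ofReal_one, one_smul]
  have h2 : T v - R.integrated μ F (T v) =
      ∫ g, ((f g : ℂ) • T v - R.π (F g) (R.u.act g (T v))) ∂μ := by
    rw [integral_sub hfc (R.integrable_π_act μ F (T v)), ← h1, integrated_apply]
  have hb : Integrable (fun g => f g * (ε * ‖T‖ * ‖v‖) + δ * ‖T‖ * ‖v‖) μ :=
    (hfi.mul_const _).add (integrable_const _)
  rw [h2]
  refine (norm_integral_le_of_norm_le hb (Filter.Eventually.of_forall fun g => ?_)).trans_eq ?_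
  · have e : (f g : ℂ) • T v - R.π (F g) (R.u.act g (T v)) =
        -((f g : ℂ) • T (σ.act g v - v)) -
          R.π (F g - algebraMap ℂ A (f g)) (T (σ.act g v)) := by
      rw [← mem_intertwiners.1 hT, map_sub, map_sub, AlgHomClass.commutes,
        sub_apply, Algebra.algebraMap_eq_smul_one]
      simp [smul_sub]
    rw [e]
    refine (norm_sub_le _ _).trans (add_le_add ?_ ?_)
    · rw [norm_neg, norm_smul, Complex.norm_real, Real.norm_of_nonneg (hf₀ g)]
      calc f g * ‖T (σ.act g v - v)‖ ≤ f g * (‖T‖ * ‖σ.act g v - v‖) :=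
            mul_le_mul_of_nonneg_left (T.le_opNorm _) (hf₀ g)
        _ = ‖T‖ * (f g * ‖σ.act g v - v‖) := by ring
        _ ≤ ‖T‖ * (f g * (ε * ‖v‖)) := mul_le_mul_of_nonneg_left (hf g v) (norm_nonneg T)
        _ = f g * (ε * ‖T‖ * ‖v‖) := by ring
    · refine (R.norm_π_apply_le _ _).trans ?_
      rw [mul_assoc]
      refine mul_le_mul (hF g) ((T.le_opNorm _).trans_eq ?_) (norm_nonneg _)
        ((norm_nonneg _).trans (hF g))
      rw [LinearIsometryEquiv.norm_map]
  · rw [integral_add (hfi.mul_const _) (integrable_const _), integral_mul_const, hf₁]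
    simp
    ring

variable [IsTopologicalGroup G] [μ.IsMulLeftInvariant]

/-- The coefficient map `v ↦ ∫ ⟪e, σ_g⁻¹ v⟫ α_g(x) dg` takes values in `A(σ)`, because it
intertwines `σ` and the action. -/
theorem integral_inner_smul_act_mem (e : V) (x : A) (v : V) :
    ∫ g, inner ℂ e (σ.act g⁻¹ v) • S.act g x ∂μ ∈ isotypicPart σ.rep S.rep := by
  have hc : ∀ v, Integrable (fun g => inner ℂ e (σ.act g⁻¹ v) • S.act g x) μ := fun v =>
    Continuous.integrable_of_compactSpace <|
      (continuous_const.inner ((σ.continuous_act v).comp continuous_inv)).smul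
        (S.continuous_act.comp (continuous_id.prodMk continuous_const))
  let T : V →ₗ[ℂ] A :=
    { toFun v := ∫ g, inner ℂ e (σ.act g⁻¹ v) • S.act g x ∂μ
      map_add' v w := by
        simp only [map_add, inner_add_right, add_smul]
        exact integral_add (hc v) (hc w)
      map_smul' c v := by
        simp only [map_smul, inner_smul_right, mul_smul, RingHom.id_apply]
        exact integral_smul c _ }
  refine Submodule.mem_iSup_of_mem
    (T.intertwiningMap_of_isIntertwiningMap σ.rep S.rep fun h v => ?_) ⟨v, rfl⟩
  change ∫ g, inner ℂ e (σ.act g⁻¹ (σ.act h v)) • S.act g x ∂μ =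
    S.act h (∫ g, inner ℂ e (σ.act g⁻¹ v) • S.act g x ∂μ)
  let α : A →L[ℂ] A :=
    ⟨(S.act h).toAlgEquiv.toLinearMap,
      S.continuous_act.comp (continuous_const.prodMk continuous_id)⟩
  change _ = α _
  rw [← ContinuousLinearMap.integral_comp_comm α (hc v),
    ← integral_mul_left_eq_self (fun g => inner ℂ e (σ.act g⁻¹ (σ.act h v)) • S.act g x) h]
  refine integral_congr_ae (Filter.Eventually.of_forall fun g => ?_)
  have h1 : σ.act (h * g)⁻¹ (σ.act h v) = σ.act g⁻¹ v := by
    rw [mul_inv_rev, act_mul_apply, act_inv_act]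
  have h2 : S.act (h * g) x = S.act h (S.act g x) := by simp
  change inner ℂ e (σ.act (h * g)⁻¹ (σ.act h v)) • S.act (h * g) x = α _
  rw [h1, h2, map_smul]
  rfl

/-- The average of `π(x) P B`, with `P` the projection onto the fixed vectors, is a finite sum
of products of elements of `A(σ)` and fixed vectors; hence so is the average of the
integrated form of any function in the range of the Ellwood map. -/
theorem averageOperator_integrated_ellwoodMap_mem [FiniteDimensional ℂ V] (t : A ⊗[ℂ] A)
    (B : V →L[ℂ] H) (v : V) :
    averageOperator μ σ R.u (R.integrated μ (S.ellwoodMap t) ∘L B) v ∈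
      Submodule.span ℂ {η : H | ∃ a ∈ isotypicPart σ.rep S.rep,
        ∃ ξ ∈ isotypicPart (Representation.trivial ℂ G ℂ) R.u.rep, R.π a ξ = η} := by
  induction t with
  | zero => simp
  | add s t hs ht =>
    rw [map_add, map_add, ContinuousLinearMap.add_comp, map_add]
    exact add_mem hs ht
  | tmul x y =>
    let b := stdOrthonormalBasis ℂ V
    let P : V → H := fun w => ∫ g, R.u.act g (R.π y (B w)) ∂μ
    have hc : ∀ i, Integrable (fun g => inner ℂ (b i) (σ.act g⁻¹ v) • S.act g x) μ := fun i =>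
      Continuous.integrable_of_compactSpace <|
        (continuous_const.inner ((σ.continuous_act v).comp continuous_inv)).smul
          (S.continuous_act.comp (continuous_id.prodMk continuous_const))
    have key : averageOperator μ σ R.u (R.integrated μ (S.ellwoodMap (x ⊗ₜ y)) ∘L B) v =
        ∑ i, R.π (∫ g, inner ℂ (b i) (σ.act g⁻¹ v) • S.act g x ∂μ) (P (b i)) := by
      let Λ : H → A →L[ℂ] H := fun ξ =>
        ⟨{ toFun a := R.π a ξ
           map_add' a b := by simp
           map_smul' c a := by simp }, R.continuous_π.clm_apply continuous_const⟩
      have hΛ : ∀ i, R.π (∫ g, inner ℂ (b i) (σ.act g⁻¹ v) • S.act g x ∂μ) (P (b i)) =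
          ∫ g, Λ (P (b i)) (inner ℂ (b i) (σ.act g⁻¹ v) • S.act g x) ∂μ := fun i =>
        ((Λ (P (b i))).integral_comp_comm (hc i)).symm
      simp only [hΛ]
      rw [← integral_finsetSum _ fun i _ => (Λ (P (b i))).integrable_comp (hc i),
        averageOperator_apply]
      refine integral_congr_ae (Filter.Eventually.of_forall fun g => ?_)
      have hPg : ∀ w, R.u.act g (R.π x (P w)) = R.π (S.act g x) (P w) := fun w => by
        rw [act_π, act_integral_act]
      change R.u.act g (R.integrated μ (S.ellwoodMap (x ⊗ₜ y)) (B (σ.act g⁻¹ v))) = _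
      conv_lhs => rw [← b.sum_repr' (σ.act g⁻¹ v)]
      simp only [map_sum, map_smul, integrated_ellwoodMap_tmul]
      exact Finset.sum_congr rfl fun i _ => congrArg _ (hPg (b i))
    rw [key]
    refine Submodule.sum_mem _ fun i _ => Submodule.subset_span
      ⟨_, integral_inner_smul_act_mem μ σ (b i) x v, P (b i), ?_, rfl⟩
    exact mem_isotypicPart_trivial.2 fun g => act_integral_act μ R.u g _

/-- For a free action, every intertwining operator takes its values in the span of
`π(A(σ)) . H(1)`. -/
theorem apply_mem_span [T2Space G] [FiniteDimensional ℂ V] [μ.IsOpenPosMeasure] (hS : S.IsFree)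
    {T : V →L[ℂ] H} (hT : T ∈ intertwiners σ R.u) (v : V) :
    T v ∈ Submodule.span ℂ {η : H | ∃ a ∈ isotypicPart σ.rep S.rep,
        ∃ ξ ∈ isotypicPart (Representation.trivial ℂ G ℂ) R.u.rep, R.π a ξ = η} := by
  -- The two errors of `1 / 4` add up to the distance `1 / 2 < 1` from the identity.
  obtain ⟨f, hf₀, hf₁, hf⟩ := exists_density_norm_sub_le μ σ (ε := 1 / 4) (by norm_num)
  let F₀ : C(G, A) := ⟨fun g => algebraMap ℂ A (f g), by fun_prop⟩
  obtain ⟨t, ht⟩ := hS.exists_dist_lt F₀ (ε := 1 / 4) (by norm_num)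
  have hF : ∀ g, ‖S.ellwoodMap t g - algebraMap ℂ A (f g)‖ ≤ 1 / 4 := fun g => by
    rw [dist_comm, dist_eq_norm] at ht
    exact ((S.ellwoodMap t - F₀).norm_coe_le_norm g).trans ht.le
  have : CompleteSpace (intertwiners σ R.u) :=
    (isClosed_intertwiners σ R.u).completeSpace_coe
  have hΦ : ∀ T : intertwiners σ R.u,
      ‖T - intertwinerCompression μ σ R.u (R.integrated μ (S.ellwoodMap t)) T‖ ≤ 1 / 2 * ‖T‖ := by
    intro T
    refine (norm_sub_intertwinerCompression_le μ σ R.u _ T).trans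
      (ContinuousLinearMap.opNorm_le_bound _ (by positivity) fun v => ?_)
    refine (R.norm_integrated_sub_le μ σ _ f hf₀ hf₁ hf hF T.2 v).trans_eq ?_
    rw [Submodule.norm_coe]
    norm_num
  have hsurj : Function.Surjective
      (intertwinerCompression μ σ R.u (R.integrated μ (S.ellwoodMap t))) :=
    LinearMap.surjective_of_norm_sub_le (X := intertwiners σ R.u) _ (c := 1 / 2)
      (by norm_num) (by norm_num) hΦ
  obtain ⟨T', hT'⟩ := hsurj ⟨T, hT⟩
  have h : averageOperator μ σ R.u
      (R.integrated μ (S.ellwoodMap t) ∘L (T' : V →L[ℂ] H)) = T := by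
    rw [← coe_intertwinerCompression, hT']
  rw [← h]
  exact R.averageOperator_integrated_ellwoodMap_mem μ σ t T' v

end CovariantRep

end CStarDynamicalSystem

/-- `π(A(σ)) . H(1) = H(σ)`, the left-hand side being the (algebraic) linear span of all products. -/
theorem corollary4p5 {A G : Type*} [CStarAlgebra A] [Group G] [TopologicalSpace G]
    [IsTopologicalGroup G] [CompactSpace G] [T2Space G]
    (S : CStarDynamicalSystem A G) (hS : S.IsFree)
    {H : Type*} [NormedAddCommGroup H] [InnerProductSpace ℂ H] [CompleteSpace H]
    (R : S.CovariantRep H)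
    {V : Type*} [NormedAddCommGroup V] [InnerProductSpace ℂ V] [FiniteDimensional ℂ V]
    (σ : UnitaryRep G V) (hσ : σ.rep.IsIrreducible) :
    Submodule.span ℂ {η : H | ∃ a ∈ isotypicPart σ.rep S.rep,
        ∃ ξ ∈ isotypicPart (Representation.trivial ℂ G ℂ) R.u.rep, R.π a ξ = η} =
      isotypicPart σ.rep R.u.rep := by
  let _ : MeasurableSpace G := borel G
  have : BorelSpace G := ⟨rfl⟩
  let μ : MeasureTheory.Measure G := MeasureTheory.Measure.haarMeasure ⊤
  have : MeasureTheory.IsProbabilityMeasure μ := ⟨MeasureTheory.Measure.haarMeasure_self⟩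
  refine le_antisymm (R.span_le_isotypicPart σ.rep) ?_
  exact UnitaryRep.isotypicPart_le_of_intertwiners σ R.u fun T hT v =>
    R.apply_mem_span μ σ hS hT v
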